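/- Let $\mu$ be a finite Borel measure on $\mathbb{C}$ whose support is compact and infinite. Let $\varphi_n$ ($n\ge 0$) be its orthonormal polynomials, obtained by applying the Gram--Schmidt process in $L^2(\mathbb{C},\mu)$ to $1,z,z^2,\dots$ and normalized so that $\varphi_n$ has degree $n$ and positive leading coefficient $\kappa_n$, and let $\Phi_n=\kappa_n^{-1}\varphi_n$ be the monic orthogonal polynomials. Suppose that $$\lim_{n\to\infty}\frac{\kappa_n}{\kappa_{n+1}}=0$$ and that there is a number $x\in\mathbb{C}$ such that $$\lim_{n\to\infty}\left(\left[\frac{z^2\,\Phi_n(z)}{\Phi_{n+1}(z)}-z\right]\bigg|_{z=\infty}\right)=x,$$ where the value at $z=\infty$ of the function in brackets, for each fixed $n$, is its limit as $|z|\to\infty$ (this limit always exists). Then for every integer $j\ge 0$ (with $x^0=1$), $$\lim_{n\to\infty}\int_{\mathbb{C}}z^j\,|\varphi_n(z)|^2\,d\mu(z)=x^j.$$ -/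

import Mathlib

open Filter Topology MeasureTheory Polynomial
open scoped ComplexConjugate

noncomputable section

namespace OrthoPoly

/-- The `L²(μ)` inner product `∫ p q̄ dμ` of two polynomials. -/
def polyInner (μ : Measure ℂ) (p q : ℂ[X]) : ℂ :=
  ∫ z, p.eval z * conj (q.eval z) ∂μ

/-- The monic orthogonal polynomials `Φ_n`, obtained by applying the (unnormalized)
Gram-Schmidt process in `L²(μ)` to the sequence `1, z, z², …`. -/
def monicOP (μ : Measure ℂ) (n : ℕ) : ℂ[X] :=
  X ^ n - ∑ k : Fin n,
    C (polyInner μ (X ^ n) (monicOP μ k) / polyInner μ (monicOP μ k) (monicOP μ k)) * monicOP μ k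
termination_by n
decreasing_by exact k.2

/-- The normalization constant `κ_n = ‖Φ_n‖⁻¹`, the norm being that of `L²(μ)`. As `Φ_n` is monic,
this is the leading coefficient of the orthonormal polynomial `φ_n`. -/
def kappa (μ : Measure ℂ) (n : ℕ) : ℝ :=
  (√(∫ z, ‖(monicOP μ n).eval z‖ ^ 2 ∂μ))⁻¹

/-- The orthonormal polynomials `φ_n = κ_n Φ_n`. -/
def orthonormalPoly (μ : Measure ℂ) (n : ℕ) : ℂ[X] :=
  C (kappa μ n : ℂ) * monicOP μ n

/-- The value at `z = ∞` of a function on the plane: its limit as `|z| → ∞`. -/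
def valueAtInfinity (f : ℂ → ℂ) : ℂ :=
  limUnder (Bornology.cobounded ℂ) f

theorem monicOP_monic_natDegree (μ : Measure ℂ) (n : ℕ) :
    (monicOP μ n).Monic ∧ (monicOP μ n).natDegree = n := by
  induction n using Nat.strong_induction_on with
  | _ n ih =>
    have hlt : (∑ k : Fin n,
        C (polyInner μ (X ^ n) (monicOP μ k) / polyInner μ (monicOP μ k) (monicOP μ k)) *
          monicOP μ k).degree < ((X : ℂ[X]) ^ n).degree := by
      rw [degree_X_pow]
      refine (degree_sum_le _ _).trans_lt ((Finset.sup_lt_iff (WithBot.bot_lt_coe n)).2 ?_)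
      intro k _
      rw [← smul_eq_C_mul]
      refine (degree_smul_le _ _).trans_lt ?_
      rw [degree_eq_natDegree (ih k k.2).1.ne_zero, (ih k k.2).2]
      exact WithBot.coe_lt_coe.2 k.2
    rw [monicOP]
    refine ⟨(monic_X_pow n).sub_of_left hlt, ?_⟩
    rw [natDegree_eq_of_degree_eq (degree_sub_eq_left_of_degree_lt hlt), natDegree_X_pow]

/-- The value at infinity of `z² Φ_n / Φ_{n+1} - z` is an honest limit. -/
theorem tendsto_valueAtInfinity (μ : Measure ℂ) (n : ℕ) :
    Tendsto (fun z : ℂ => z ^ 2 * (monicOP μ n).eval z / (monicOP μ (n + 1)).eval z - z)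
      (Bornology.cobounded ℂ)
      (𝓝 (valueAtInfinity fun z : ℂ =>
        z ^ 2 * (monicOP μ n).eval z / (monicOP μ (n + 1)).eval z - z)) := by
  refine tendsto_nhds_limUnder ?_
  obtain ⟨hP, hPd⟩ := monicOP_monic_natDegree μ n
  obtain ⟨hQ, hQd⟩ := monicOP_monic_natDegree μ (n + 1)
  set P := monicOP μ n
  set Q := monicOP μ (n + 1)
  have hXP : (X * P).natDegree = n + 1 := by rw [natDegree_X_mul hP.ne_zero, hPd]
  have hR : (X * (X * P - Q)).natDegree ≤ n + 1 := by
    have hlt : (X * P - Q).degree < (X * P).degree := by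
      refine degree_sub_lt_left ?_ (monic_X.mul hP).ne_zero ?_
      · rw [degree_eq_natDegree (monic_X.mul hP).ne_zero, degree_eq_natDegree hQ.ne_zero, hXP, hQd]
      · rw [(monic_X.mul hP).leadingCoeff, hQ.leadingCoeff]
    rw [degree_eq_natDegree (monic_X.mul hP).ne_zero, hXP] at hlt
    by_cases h0 : X * P - Q = 0
    · simp [h0]
    · rw [natDegree_X_mul h0]
      have := (natDegree_lt_iff_degree_lt h0).2 hlt
      omega
  have key : ∀ p : ℂ[X], p.natDegree ≤ n + 1 → ∀ z : ℂ, z ≠ 0 →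
      p.eval z = (reflect (n + 1) p).eval z⁻¹ * z ^ (n + 1) := by
    intro p hp z hz
    let _ := invertibleOfNonzero hz
    have h := eval₂_reflect_mul_pow (RingHom.id ℂ) z (n + 1) p hp
    rw [invOf_eq_inv] at h
    exact h.symm
  have hlim : ∀ p : ℂ[X], Tendsto (fun z : ℂ => (reflect (n + 1) p).eval z⁻¹)
      (Bornology.cobounded ℂ) (𝓝 ((reflect (n + 1) p).eval 0)) := fun p =>
    ((reflect (n + 1) p).continuous.tendsto 0).comp tendsto_inv₀_cobounded
  have hQ0 : (reflect (n + 1) Q).eval 0 = 1 := by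
    rw [← coeff_zero_eq_eval_zero, coeff_reflect, revAt_le (Nat.zero_le _)]
    simpa [hQd] using hQ.coeff_natDegree
  have hdiv := (hlim (X * (X * P - Q))).div (hlim Q) (by rw [hQ0]; exact one_ne_zero)
  refine ⟨_, hdiv.congr' ?_⟩
  have hne : ∀ᶠ z in Bornology.cobounded ℂ, (reflect (n + 1) Q).eval z⁻¹ ≠ 0 :=
    (hlim Q).eventually_ne (by rw [hQ0]; exact one_ne_zero)
  filter_upwards [hne, Bornology.eventually_ne_cobounded (0 : ℂ)] with z hz hz0
  have h1 := key _ hR z hz0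
  have h2 := key Q hQd.le z hz0
  have h3 : Q.eval z ≠ 0 := by
    rw [h2]
    exact mul_ne_zero hz (pow_ne_zero _ hz0)
  simp only [Pi.div_apply]
  rw [← mul_div_mul_right _ _ (pow_ne_zero (n + 1) hz0), ← h1, ← h2]
  simp only [eval_mul, eval_X, eval_sub]
  field_simp

end OrthoPoly

end

/-!
In the orthonormal basis `φ_n`, multiplication by `z` has an upper Hessenberg matrix whose
subdiagonal entries are `κ_n / κ_{n+1}` and whose diagonal entries are the values at infinity in the
hypothesis. Since `‖z̄ φ_n‖ = ‖z φ_n‖`, comparing the square sums of the first `N + 1` rows and of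
the first `N + 1` columns bounds the part of column `N + 1` above the diagonal by `κ_N / κ_{N+1}`.
Hence `‖(z - x) φ_n‖ → 0`: the probability measures `|φ_n|² dμ` concentrate at `x`.
-/

noncomputable section

namespace OrthoPoly

section HyponormalHessenberg

variable {ι 𝕜 E : Type*} [RCLike 𝕜] [NormedAddCommGroup E] [InnerProductSpace 𝕜 E]

theorem norm_sq_eq_sum_of_mem_span {φ : ι → E} (hφ : Orthonormal 𝕜 φ) {s : Finset ι} {u : E}
    (hu : u ∈ Submodule.span 𝕜 (φ '' s)) : ‖u‖ ^ 2 = ∑ i ∈ s, ‖inner 𝕜 (φ i) u‖ ^ 2 := by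
  obtain ⟨c, rfl⟩ := (Submodule.mem_span_image_finset_iff_exists_fun' 𝕜).1 hu
  have hcoeff : ∀ i ∈ s, inner 𝕜 (φ i) (∑ k ∈ s, c k • φ k) = c i := fun i hi =>
    hφ.inner_right_sum c hi
  rw [@norm_sq_eq_re_inner 𝕜, hφ.inner_sum, map_sum]
  refine Finset.sum_congr rfl fun i hi => ?_
  rw [hcoeff i hi, RCLike.conj_mul, ← RCLike.ofReal_pow, RCLike.ofReal_re]

theorem inner_eq_zero_of_mem_span {φ : ι → E} (hφ : Orthonormal 𝕜 φ) {s : Set ι} {i : ι}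
    (hi : i ∉ s) {u : E} (hu : u ∈ Submodule.span 𝕜 (φ '' s)) : inner 𝕜 (φ i) u = 0 := by
  have hle : Submodule.span 𝕜 (φ '' s) ≤ (𝕜 ∙ φ i)ᗮ := by
    rw [Submodule.span_le]
    rintro _ ⟨k, hk, rfl⟩
    exact Submodule.mem_orthogonal_singleton_iff_inner_right.2
      (hφ.inner_eq_zero (ne_of_mem_of_not_mem hk hi).symm)
  exact Submodule.mem_orthogonal_singleton_iff_inner_right.1 (hle hu)

/-- The vectors `u n` and `w n` are the images of `φ n`, for an orthonormal sequence `φ`, under an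
operator and its adjoint, the operator having an upper Hessenberg matrix with respect to `φ` and
satisfying the inequality of hyponormality on the vectors `φ n`. The operator itself is not part of
the data, so that it may be unbounded. -/
structure IsHyponormalHessenberg (𝕜 : Type*) {E : Type*} [RCLike 𝕜] [NormedAddCommGroup E]
    [InnerProductSpace 𝕜 E] (φ u w : ℕ → E) : Prop where
  orthonormal : Orthonormal 𝕜 φ
  mem_span : ∀ n, u n ∈ Submodule.span 𝕜 (φ '' Set.Iio (n + 2))
  inner_adjoint : ∀ m n, inner 𝕜 (w m) (φ n) = inner 𝕜 (φ m) (u n)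
  norm_adjoint_le : ∀ n, ‖w n‖ ≤ ‖u n‖

namespace IsHyponormalHessenberg

variable {φ u w : ℕ → E}

theorem inner_eq_zero (h : IsHyponormalHessenberg 𝕜 φ u w) {m n : ℕ} (hmn : n + 2 ≤ m) :
    inner 𝕜 (φ m) (u n) = 0 :=
  inner_eq_zero_of_mem_span h.orthonormal (by simpa using hmn) (h.mem_span n)

theorem norm_sq_eq_sum (h : IsHyponormalHessenberg 𝕜 φ u w) {n N : ℕ} (hn : n + 2 ≤ N) :
    ‖u n‖ ^ 2 = ∑ m ∈ Finset.range N, ‖inner 𝕜 (φ m) (u n)‖ ^ 2 := by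
  refine norm_sq_eq_sum_of_mem_span h.orthonormal (Submodule.span_mono ?_ (h.mem_span n))
  rw [Finset.coe_range]
  exact Set.image_mono (Set.Iio_subset_Iio hn)

theorem sum_norm_sq_eq (h : IsHyponormalHessenberg 𝕜 φ u w) (N : ℕ) :
    ∑ n ∈ Finset.range (N + 1), ‖u n‖ ^ 2 =
      (∑ n ∈ Finset.range (N + 1), ∑ m ∈ Finset.range (N + 1), ‖inner 𝕜 (φ m) (u n)‖ ^ 2) +
        ‖inner 𝕜 (φ (N + 1)) (u N)‖ ^ 2 := by
  have hcol : ∀ n ∈ Finset.range (N + 1), ‖u n‖ ^ 2 =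
      ∑ m ∈ Finset.range (N + 1), ‖inner 𝕜 (φ m) (u n)‖ ^ 2 +
        ‖inner 𝕜 (φ (N + 1)) (u n)‖ ^ 2 := fun n hn => by
    rw [h.norm_sq_eq_sum (N := N + 2) (by grind), Finset.sum_range_succ]
  have hbelow : ∀ n ∈ Finset.range N, ‖inner 𝕜 (φ (N + 1)) (u n)‖ ^ 2 = 0 := fun n hn => by
    simp [h.inner_eq_zero (show n + 2 ≤ N + 1 by grind)]
  rw [Finset.sum_congr rfl hcol, Finset.sum_add_distrib, Finset.sum_range_succ (fun n =>
    ‖inner 𝕜 (φ (N + 1)) (u n)‖ ^ 2), Finset.sum_eq_zero hbelow, zero_add]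

theorem sum_norm_adjoint_sq_ge (h : IsHyponormalHessenberg 𝕜 φ u w) (N : ℕ) :
    (∑ n ∈ Finset.range N, ∑ m ∈ Finset.range N, ‖inner 𝕜 (φ m) (u n)‖ ^ 2) +
        ∑ n ∈ Finset.range N, ‖inner 𝕜 (φ n) (u N)‖ ^ 2 ≤
      ∑ n ∈ Finset.range N, ‖w n‖ ^ 2 := by
  rw [Finset.sum_comm, ← Finset.sum_add_distrib]
  refine Finset.sum_le_sum fun n _ => ?_
  rw [← Finset.sum_range_succ (fun m => ‖inner 𝕜 (φ n) (u m)‖ ^ 2)]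
  simpa only [← h.inner_adjoint, norm_inner_symm (w n)] using
    h.orthonormal.sum_inner_products_le (w n) (s := Finset.range (N + 1))

/-- The `(N + 1) × (N + 1)` corner of the matrix contributes equally to the sums of `‖u n‖ ^ 2` and
of `‖w n‖ ^ 2` over `n ≤ N`. What remains of the first sum is a single subdiagonal entry, and
hyponormality compares it with what remains of the second. -/
theorem sum_norm_inner_sq_le (h : IsHyponormalHessenberg 𝕜 φ u w) (N : ℕ) :
    ∑ n ∈ Finset.range (N + 1), ‖inner 𝕜 (φ n) (u (N + 1))‖ ^ 2 ≤
      ‖inner 𝕜 (φ (N + 1)) (u N)‖ ^ 2 := by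
  have hsum : ∑ n ∈ Finset.range (N + 1), ‖w n‖ ^ 2 ≤ ∑ n ∈ Finset.range (N + 1), ‖u n‖ ^ 2 :=
    Finset.sum_le_sum fun n _ => by gcongr; exact h.norm_adjoint_le n
  linarith [h.sum_norm_adjoint_sq_ge (N + 1), h.sum_norm_sq_eq N]

theorem norm_sub_smul_sq_le (h : IsHyponormalHessenberg 𝕜 φ u w) (x : 𝕜) (n : ℕ) :
    ‖u (n + 1) - x • φ (n + 1)‖ ^ 2 ≤ ‖inner 𝕜 (φ (n + 1)) (u n)‖ ^ 2 +
      ‖inner 𝕜 (φ (n + 1)) (u (n + 1)) - x‖ ^ 2 + ‖inner 𝕜 (φ (n + 2)) (u (n + 1))‖ ^ 2 := by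
  have hmem : u (n + 1) - x • φ (n + 1) ∈ Submodule.span 𝕜 (φ '' Finset.range (n + 3)) := by
    rw [Finset.coe_range]
    exact sub_mem (h.mem_span (n + 1)) (Submodule.smul_mem _ _
      (Submodule.subset_span (Set.mem_image_of_mem _ (by simp))))
  have hentry : ∀ m, inner 𝕜 (φ m) (u (n + 1) - x • φ (n + 1)) =
      inner 𝕜 (φ m) (u (n + 1)) - if m = n + 1 then x else 0 := fun m => by
    rw [inner_sub_right, inner_smul_right, orthonormal_iff_ite.1 h.orthonormal, mul_ite, mul_one,
      mul_zero]
  have habove : ∑ m ∈ Finset.range (n + 1), ‖inner 𝕜 (φ m) (u (n + 1) - x • φ (n + 1))‖ ^ 2 =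
      ∑ m ∈ Finset.range (n + 1), ‖inner 𝕜 (φ m) (u (n + 1))‖ ^ 2 :=
    Finset.sum_congr rfl fun m hm => by
      rw [hentry, if_neg (Finset.mem_range.1 hm).ne, sub_zero]
  rw [norm_sq_eq_sum_of_mem_span h.orthonormal hmem, Finset.sum_range_succ, Finset.sum_range_succ,
    habove, hentry, hentry, if_pos rfl, if_neg (by simp), sub_zero]
  gcongr
  exact h.sum_norm_inner_sq_le n

theorem tendsto_sub_smul (h : IsHyponormalHessenberg 𝕜 φ u w) {x : 𝕜}
    (hsub : Tendsto (fun n => inner 𝕜 (φ (n + 1)) (u n)) atTop (𝓝 0))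
    (hdiag : Tendsto (fun n => inner 𝕜 (φ n) (u n)) atTop (𝓝 x)) :
    Tendsto (fun n => u n - x • φ n) atTop (𝓝 0) := by
  rw [← tendsto_add_atTop_iff_nat 1, tendsto_zero_iff_norm_tendsto_zero]
  have hsub' := (tendsto_add_atTop_iff_nat 1).2 hsub
  have hdiag' := ((tendsto_add_atTop_iff_nat 1).2 hdiag).sub_const x
  have hbound := ((hsub.norm.pow 2).add (hdiag'.norm.pow 2)).add (hsub'.norm.pow 2)
  have hsq := squeeze_zero (fun n => by positivity) (h.norm_sub_smul_sq_le x)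
    (by simpa using hbound)
  simpa using hsq.sqrt

end IsHyponormalHessenberg

end HyponormalHessenberg

section PolynomialQuotients

variable {𝕜 : Type*}

theorem degree_sub_C_mul_lt [Field 𝕜] {p q : 𝕜[X]} (hq : q ≠ 0) (hpq : p.degree ≤ q.degree) :
    (p - C (p.coeff q.natDegree / q.leadingCoeff) * q).degree < q.degree := by
  have hlc : q.leadingCoeff ≠ 0 := leadingCoeff_ne_zero.2 hq
  rw [degree_eq_natDegree hq] at hpq ⊢
  rw [degree_lt_iff_coeff_zero]
  intro m hm
  rw [coeff_sub, coeff_C_mul]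
  rcases hm.eq_or_lt with rfl | hlt
  · rw [coeff_natDegree, div_mul_cancel₀ _ hlc, sub_self]
  · rw [coeff_eq_zero_of_degree_lt (hpq.trans_lt (WithBot.coe_lt_coe.2 hlt)),
      coeff_eq_zero_of_natDegree_lt hlt, mul_zero, sub_zero]

theorem tendsto_eval_div_eval_cobounded [NormedField 𝕜] {p q : 𝕜[X]} (hq : q ≠ 0)
    (hpq : p.degree ≤ q.degree) :
    Tendsto (fun z => p.eval z / q.eval z) (Bornology.cobounded 𝕜)
      (𝓝 (p.coeff q.natDegree / q.leadingCoeff)) := by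
  have hlim := (isLittleO_cobounded_of_degree_lt
    (degree_sub_C_mul_lt hq hpq)).tendsto_div_nhds_zero.add_const
      (p.coeff q.natDegree / q.leadingCoeff)
  rw [zero_add] at hlim
  have hq0 : ∀ᶠ z in Bornology.cobounded 𝕜, q.eval z ≠ 0 :=
    Bornology.le_cofinite 𝕜 (eventually_cofinite_not_isRoot hq)
  refine hlim.congr' ?_
  filter_upwards [hq0] with z hz
  rw [eval_sub, eval_mul, eval_C, sub_div, mul_div_cancel_right₀ _ hz, sub_add_cancel]

end PolynomialQuotients

section Concentration

variable {α ι E : Type*} [PseudoMetricSpace α] [MeasurableSpace α] {μ : Measure α}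
  [NormedAddCommGroup E] {x : α} {f : α → E}

theorem exists_ae_norm_sub_le_add_mul_sq_dist (hbdd : ∃ B, ∀ᵐ z ∂μ, ‖f z‖ ≤ B)
    (hcont : ContinuousAt f x) {ε : ℝ} (hε : 0 < ε) :
    ∃ K, ∀ᵐ z ∂μ, ‖f z - f x‖ ≤ ε + K * dist z x ^ 2 := by
  obtain ⟨B, hB⟩ := hbdd
  obtain ⟨δ, hδ, hfδ⟩ := Metric.continuousAt_iff.1 hcont ε hε
  refine ⟨(|B| + ‖f x‖) / δ ^ 2, ?_⟩
  filter_upwards [hB] with z hz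
  rcases lt_or_ge (dist z x) δ with hnear | hfar
  · rw [← dist_eq_norm]
    exact (hfδ hnear).le.trans (le_add_of_nonneg_right (by positivity))
  · calc ‖f z - f x‖ ≤ ‖f z‖ + ‖f x‖ := norm_sub_le _ _
      _ ≤ |B| + ‖f x‖ := by gcongr; exact hz.trans (le_abs_self B)
      _ = (|B| + ‖f x‖) / δ ^ 2 * δ ^ 2 := (div_mul_cancel₀ _ (by positivity)).symm
      _ ≤ (|B| + ‖f x‖) / δ ^ 2 * dist z x ^ 2 := by gcongr
      _ ≤ ε + (|B| + ‖f x‖) / δ ^ 2 * dist z x ^ 2 := le_add_of_nonneg_left hε.le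

variable [NormedSpace ℝ E] [CompleteSpace E]

theorem dist_integral_smul_le {w : α → ℝ} (hw0 : ∀ z, 0 ≤ w z) (hw : Integrable w μ)
    (hw1 : ∫ z, w z ∂μ = 1) (hwx : Integrable (fun z => dist z x ^ 2 * w z) μ)
    (hwf : Integrable (fun z => w z • f z) μ) {ε K : ℝ}
    (hfx : ∀ᵐ z ∂μ, ‖f z - f x‖ ≤ ε + K * dist z x ^ 2) :
    dist (∫ z, w z • f z ∂μ) (f x) ≤ ε + K * ∫ z, dist z x ^ 2 * w z ∂μ := by
  have hsub : ∫ z, w z • f z ∂μ - f x = ∫ z, w z • (f z - f x) ∂μ := by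
    simp only [smul_sub]
    rw [integral_sub hwf (hw.smul_const _), integral_smul_const, hw1, one_smul]
  calc dist (∫ z, w z • f z ∂μ) (f x)
      ≤ ∫ z, (ε * w z + K * (dist z x ^ 2 * w z)) ∂μ := by
        rw [dist_eq_norm, hsub]
        refine norm_integral_le_of_norm_le ((hw.const_mul ε).add (hwx.const_mul K)) ?_
        filter_upwards [hfx] with z hz
        rw [norm_smul, Real.norm_of_nonneg (hw0 z)]
        linarith [mul_le_mul_of_nonneg_left hz (hw0 z)]
    _ = ε + K * ∫ z, dist z x ^ 2 * w z ∂μ := by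
        rw [integral_add (hw.const_mul _) (hwx.const_mul _), integral_const_mul,
          integral_const_mul, hw1, mul_one]

theorem tendsto_integral_smul_of_tendsto_integral_sq_dist {l : Filter ι} {w : ι → α → ℝ}
    (hw0 : ∀ i z, 0 ≤ w i z) (hw : ∀ i, Integrable (w i) μ) (hw1 : ∀ i, ∫ z, w i z ∂μ = 1)
    (hwx : ∀ i, Integrable (fun z => dist z x ^ 2 * w i z) μ)
    (hlim : Tendsto (fun i => ∫ z, dist z x ^ 2 * w i z ∂μ) l (𝓝 0))
    (hf : AEStronglyMeasurable f μ) (hbdd : ∃ B, ∀ᵐ z ∂μ, ‖f z‖ ≤ B) (hcont : ContinuousAt f x) :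
    Tendsto (fun i => ∫ z, w i z • f z ∂μ) l (𝓝 (f x)) := by
  have hwf : ∀ i, Integrable (fun z => w i z • f z) μ := fun i => by
    obtain ⟨B, hB⟩ := hbdd
    exact (hw i).smul_bdd B hf hB
  rw [Metric.tendsto_nhds]
  intro ε hε
  obtain ⟨K, hK⟩ := exists_ae_norm_sub_le_add_mul_sq_dist hbdd hcont (half_pos hε)
  have hbound := (hlim.const_mul K).const_add (ε / 2)
  rw [mul_zero, add_zero] at hbound
  filter_upwards [hbound.eventually_lt_const (half_lt_self hε)] with i hi
  exact (dist_integral_smul_le (hw0 i) (hw i) (hw1 i) (hwx i) (hwf i) hK).trans_lt hi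

end Concentration

section PolynomialsInL2

variable {μ : Measure ℂ}

/-- All absolute moments of `μ` are finite, i.e. every polynomial lies in `L²(μ)`. This includes
the finiteness of `μ`, its moment of order zero. -/
def HasFiniteMoments (μ : Measure ℂ) : Prop :=
  ∀ n : ℕ, Integrable (fun z : ℂ => ‖z‖ ^ n) μ

theorem ae_norm_pow_le_of_isCompact_support (hc : IsCompact μ.support) (n : ℕ) :
    ∃ B, ∀ᵐ z ∂μ, ‖z ^ n‖ ≤ B := by
  obtain ⟨B, hB⟩ := hc.exists_bound_of_continuousOn (continuous_pow n).continuousOn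
  exact ⟨B, by filter_upwards [μ.support_mem_ae] with z hz using hB z hz⟩

theorem hasFiniteMoments_of_isCompact_support [IsFiniteMeasure μ] (hc : IsCompact μ.support) :
    HasFiniteMoments μ := fun n => by
  obtain ⟨B, hB⟩ := ae_norm_pow_le_of_isCompact_support hc n
  exact Integrable.of_bound (by fun_prop) B (by simpa using hB)

theorem HasFiniteMoments.memLp_eval (hμ : HasFiniteMoments μ) (p : ℂ[X]) :
    MemLp (fun z => p.eval z) 2 μ := by
  have hpow : ∀ n : ℕ, MemLp (fun z : ℂ => z ^ n) 2 μ := fun n => by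
    rw [memLp_two_iff_integrable_sq_norm (by fun_prop)]
    simpa only [norm_pow, ← pow_mul] using hμ (n * 2)
  simp only [eval_eq_sum_range]
  exact memLp_finsetSum _ fun n _ => (hpow n).const_mul _

/-- The map sending a polynomial to its class in `L²(μ)`. -/
def toL2 (hμ : HasFiniteMoments μ) : ℂ[X] →ₗ[ℂ] Lp ℂ 2 μ where
  toFun p := (hμ.memLp_eval p).toLp _
  map_add' p q := by
    rw [← MemLp.toLp_add]
    exact MemLp.toLp_congr _ _ (ae_of_all _ fun z => eval_add)
  map_smul' c p := by
    rw [RingHom.id_apply, ← MemLp.toLp_const_smul]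
    exact MemLp.toLp_congr _ _ (ae_of_all _ fun z => eval_smul _ _ _)

theorem coeFn_toL2 (hμ : HasFiniteMoments μ) (p : ℂ[X]) :
    toL2 hμ p =ᵐ[μ] fun z => p.eval z :=
  (hμ.memLp_eval p).coeFn_toLp

theorem inner_toL2 (hμ : HasFiniteMoments μ) (p q : ℂ[X]) :
    inner ℂ (toL2 hμ q) (toL2 hμ p) = polyInner μ p q := by
  rw [L2.inner_def, polyInner]
  refine integral_congr_ae ?_
  filter_upwards [coeFn_toL2 hμ p, coeFn_toL2 hμ q] with z hp hq
  rw [hp, hq, RCLike.inner_apply]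

theorem norm_toL2_sq (hμ : HasFiniteMoments μ) (p : ℂ[X]) :
    ‖toL2 hμ p‖ ^ 2 = ∫ z, ‖p.eval z‖ ^ 2 ∂μ := by
  apply Complex.ofReal_injective
  rw [Complex.ofReal_pow, ← integral_complex_ofReal]
  refine (inner_self_eq_norm_sq_to_K (𝕜 := ℂ) (toL2 hμ p)).symm.trans ?_
  simp only [inner_toL2, polyInner, Complex.mul_conj', Complex.ofReal_pow]

theorem ker_toL2 (hμ : HasFiniteMoments μ) (hinf : μ.support.Infinite) :
    LinearMap.ker (toL2 hμ) = ⊥ := by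
  rw [LinearMap.ker_eq_bot']
  intro p hp
  have hzero : ∀ᵐ z ∂μ, p.eval z = 0 := by
    filter_upwards [coeFn_toL2 hμ p, Lp.coeFn_zero ℂ 2 μ] with z hpz h0
    rw [← hpz, hp, h0, Pi.zero_apply]
  have hsupp : μ.support ⊆ {z | p.IsRoot z} :=
    μ.support_subset_of_isClosed (isClosed_eq p.continuous continuous_const) hzero
  exact eq_zero_of_infinite_isRoot p (hinf.mono hsupp)

theorem linearIndependent_toL2_X_pow (hμ : HasFiniteMoments μ) (hinf : μ.support.Infinite) :
    LinearIndependent ℂ fun n : ℕ => toL2 hμ (X ^ n) := by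
  have h := (basisMonomials ℂ).linearIndependent.map' (toL2 hμ) (ker_toL2 hμ hinf)
  simpa only [Function.comp_def, coe_basisMonomials, monomial_one_right_eq_X_pow] using h

theorem memLp_conj_mul_eval (hμ : HasFiniteMoments μ) (p : ℂ[X]) :
    MemLp (fun z => conj z * p.eval z) 2 μ :=
  (hμ.memLp_eval (X * p)).congr_norm (by fun_prop) (ae_of_all _ fun z => by simp)

/-- The class in `L²(μ)` of `z̄ p(z)`, which is the adjoint of multiplication by `z` applied to
`p`. -/
def conjMulL2 (hμ : HasFiniteMoments μ) (p : ℂ[X]) : Lp ℂ 2 μ :=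
  (memLp_conj_mul_eval hμ p).toLp _

theorem coeFn_conjMulL2 (hμ : HasFiniteMoments μ) (p : ℂ[X]) :
    conjMulL2 hμ p =ᵐ[μ] fun z => conj z * p.eval z :=
  (memLp_conj_mul_eval hμ p).coeFn_toLp

theorem norm_conjMulL2 (hμ : HasFiniteMoments μ) (p : ℂ[X]) :
    ‖conjMulL2 hμ p‖ = ‖toL2 hμ (X * p)‖ := by
  have h : ∀ᵐ z ∂μ, ‖conjMulL2 hμ p z‖ = ‖toL2 hμ (X * p) z‖ := by
    filter_upwards [coeFn_conjMulL2 hμ p, coeFn_toL2 hμ (X * p)] with z h₁ h₂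
    rw [h₁, h₂, eval_mul, eval_X, norm_mul, norm_mul, RCLike.norm_conj]
  exact le_antisymm (Lp.norm_le_norm_of_ae_le (h.mono fun _ => Eq.le))
    (Lp.norm_le_norm_of_ae_le (h.mono fun _ => Eq.ge))

theorem inner_conjMulL2 (hμ : HasFiniteMoments μ) (p q : ℂ[X]) :
    inner ℂ (conjMulL2 hμ p) (toL2 hμ q) = inner ℂ (toL2 hμ p) (toL2 hμ (X * q)) := by
  rw [L2.inner_def, L2.inner_def]
  refine integral_congr_ae ?_
  filter_upwards [coeFn_conjMulL2 hμ p, coeFn_toL2 hμ p, coeFn_toL2 hμ q,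
    coeFn_toL2 hμ (X * q)] with z hzp hp hq hzq
  simp only [hzp, hp, hq, hzq, RCLike.inner_apply, eval_mul, eval_X, map_mul, RCLike.conj_conj]
  ring

end PolynomialsInL2

section OrthogonalPolynomials

open InnerProductSpace

variable {μ : Measure ℂ}

theorem toL2_monicOP (hμ : HasFiniteMoments μ) (n : ℕ) :
    toL2 hμ (monicOP μ n) = gramSchmidt ℂ (fun k => toL2 hμ (X ^ k)) n := by
  induction n using Nat.strong_induction_on with
  | _ n ih =>
    rw [monicOP, gramSchmidt_def, map_sub, map_sum, Nat.Iio_eq_range, Finset.sum_range]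
    congr 1
    refine Finset.sum_congr rfl fun k _ => ?_
    rw [← smul_eq_C_mul, map_smul, Submodule.starProjection_singleton, ← ih k k.2, ← inner_toL2 hμ,
      ← inner_toL2 hμ, inner_self_eq_norm_sq_to_K, RCLike.ofReal_pow]

theorem kappa_eq_inv_norm (hμ : HasFiniteMoments μ) (n : ℕ) :
    kappa μ n = ‖toL2 hμ (monicOP μ n)‖⁻¹ := by
  rw [kappa, ← norm_toL2_sq hμ, Real.sqrt_sq (norm_nonneg _)]

theorem toL2_orthonormalPoly (hμ : HasFiniteMoments μ) (n : ℕ) :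
    toL2 hμ (orthonormalPoly μ n) = gramSchmidtNormed ℂ (fun k => toL2 hμ (X ^ k)) n := by
  rw [orthonormalPoly, ← smul_eq_C_mul, map_smul, kappa_eq_inv_norm hμ, toL2_monicOP,
    gramSchmidtNormed, Complex.ofReal_inv]
  rfl

theorem orthonormal_toL2_orthonormalPoly (hμ : HasFiniteMoments μ) (hinf : μ.support.Infinite) :
    Orthonormal ℂ fun n => toL2 hμ (orthonormalPoly μ n) := by
  simpa only [toL2_orthonormalPoly] using
    gramSchmidtNormed_orthonormal (linearIndependent_toL2_X_pow hμ hinf)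

theorem toL2_mem_span_orthonormalPoly (hμ : HasFiniteMoments μ) {p : ℂ[X]} {n : ℕ}
    (hp : p.degree < n) :
    toL2 hμ p ∈ Submodule.span ℂ ((fun k => toL2 hμ (orthonormalPoly μ k)) '' Set.Iio n) := by
  simp only [toL2_orthonormalPoly]
  rw [span_gramSchmidtNormed, span_gramSchmidt_Iio]
  have hmem := Submodule.mem_map_of_mem (f := toL2 hμ) (mem_degreeLT.2 hp)
  rwa [degreeLT_eq_span_X_pow, Submodule.map_span, Finset.coe_image, Finset.coe_range,
    Set.image_image] at hmem

theorem inner_orthonormalPoly_of_degree_lt (hμ : HasFiniteMoments μ) (hinf : μ.support.Infinite)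
    {p : ℂ[X]} {n : ℕ} (hp : p.degree < n) :
    inner ℂ (toL2 hμ (orthonormalPoly μ n)) (toL2 hμ p) = 0 :=
  inner_eq_zero_of_mem_span (orthonormal_toL2_orthonormalPoly hμ hinf) (by simp)
    (toL2_mem_span_orthonormalPoly hμ hp)

theorem kappa_pos (hμ : HasFiniteMoments μ) (hinf : μ.support.Infinite) (n : ℕ) :
    0 < kappa μ n := by
  rw [kappa_eq_inv_norm hμ, toL2_monicOP]
  exact inv_pos.2 (norm_pos_iff.2 (gramSchmidt_ne_zero n (linearIndependent_toL2_X_pow hμ hinf)))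

theorem degree_monicOP (μ : Measure ℂ) (n : ℕ) : (monicOP μ n).degree = n := by
  obtain ⟨hmonic, hdeg⟩ := monicOP_monic_natDegree μ n
  rw [degree_eq_natDegree hmonic.ne_zero, hdeg]

theorem inner_orthonormalPoly_of_degree_le (hμ : HasFiniteMoments μ) (hinf : μ.support.Infinite)
    {p : ℂ[X]} {n : ℕ} (hp : p.degree ≤ n) :
    inner ℂ (toL2 hμ (orthonormalPoly μ n)) (toL2 hμ p) = p.coeff n / kappa μ n := by
  obtain ⟨hmonic, hdeg⟩ := monicOP_monic_natDegree μ n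
  have hκ : (kappa μ n : ℂ) ≠ 0 := Complex.ofReal_ne_zero.2 (kappa_pos hμ hinf n).ne'
  have hlower : (p - (p.coeff n / kappa μ n) • orthonormalPoly μ n).degree < n := by
    have h := degree_sub_C_mul_lt hmonic.ne_zero (hp.trans_eq (degree_monicOP μ n).symm)
    rwa [hdeg, hmonic.leadingCoeff, div_one, degree_monicOP,
      ← div_mul_cancel₀ (p.coeff n) hκ, C_mul, mul_assoc, ← smul_eq_C_mul] at h
  have h := inner_orthonormalPoly_of_degree_lt hμ hinf hlower
  rwa [map_sub, map_smul, inner_sub_right, inner_smul_right, inner_self_eq_norm_sq_to_K,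
    (orthonormal_toL2_orthonormalPoly hμ hinf).1, RCLike.ofReal_one, one_pow, mul_one,
    sub_eq_zero] at h

theorem degree_orthonormalPoly_le (μ : Measure ℂ) (n : ℕ) : (orthonormalPoly μ n).degree ≤ n := by
  rw [orthonormalPoly, ← smul_eq_C_mul]
  exact (degree_smul_le _ _).trans_eq (degree_monicOP μ n)

theorem coeff_orthonormalPoly (μ : Measure ℂ) (n : ℕ) :
    (orthonormalPoly μ n).coeff n = kappa μ n := by
  obtain ⟨hmonic, hdeg⟩ := monicOP_monic_natDegree μ n
  have hcoeff := hmonic.coeff_natDegree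
  rw [hdeg] at hcoeff
  rw [orthonormalPoly, coeff_C_mul, hcoeff, mul_one]

theorem degree_X_mul_orthonormalPoly_le (μ : Measure ℂ) (n : ℕ) :
    (X * orthonormalPoly μ n).degree ≤ ((n + 1 : ℕ) : WithBot ℕ) := by
  rw [degree_mul, degree_X, add_comm]
  push_cast
  gcongr
  exact degree_orthonormalPoly_le μ n

theorem inner_orthonormalPoly_succ_X_mul (hμ : HasFiniteMoments μ) (hinf : μ.support.Infinite)
    (n : ℕ) :
    inner ℂ (toL2 hμ (orthonormalPoly μ (n + 1))) (toL2 hμ (X * orthonormalPoly μ n)) =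
      ((kappa μ n / kappa μ (n + 1) : ℝ) : ℂ) := by
  rw [inner_orthonormalPoly_of_degree_le hμ hinf (degree_X_mul_orthonormalPoly_le μ n),
    coeff_X_mul, coeff_orthonormalPoly, Complex.ofReal_div]

theorem degree_X_mul_monicOP_sub_le (μ : Measure ℂ) (n : ℕ) :
    (X * monicOP μ n - monicOP μ (n + 1)).degree ≤ (n : WithBot ℕ) := by
  have hX : (X * monicOP μ n).degree = ((n + 1 : ℕ) : WithBot ℕ) := by
    rw [degree_mul, degree_X, degree_monicOP, add_comm]
    rfl
  have hmonic := (monic_X (R := ℂ)).mul (monicOP_monic_natDegree μ n).1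
  have hlt := degree_sub_lt_left (hX.trans (degree_monicOP μ (n + 1)).symm) hmonic.ne_zero
    (hmonic.leadingCoeff.trans (monicOP_monic_natDegree μ (n + 1)).1.leadingCoeff.symm)
  rw [hX] at hlt
  exact Order.le_of_lt_succ hlt

theorem inner_orthonormalPoly_X_mul (hμ : HasFiniteMoments μ) (hinf : μ.support.Infinite) (n : ℕ) :
    inner ℂ (toL2 hμ (orthonormalPoly μ n)) (toL2 hμ (X * orthonormalPoly μ n)) =
      (X * monicOP μ n - monicOP μ (n + 1)).coeff n := by
  have hκ : (kappa μ n : ℂ) ≠ 0 := Complex.ofReal_ne_zero.2 (kappa_pos hμ hinf n).ne'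
  have horth : inner ℂ (toL2 hμ (orthonormalPoly μ n)) (toL2 hμ (monicOP μ (n + 1))) = 0 := by
    rw [toL2_orthonormalPoly, toL2_monicOP, gramSchmidtNormed, inner_smul_left,
      gramSchmidt_orthogonal ℂ _ n.succ_ne_self.symm, mul_zero]
  have hsplit : X * orthonormalPoly μ n = (kappa μ n : ℂ) •
      ((X * monicOP μ n - monicOP μ (n + 1)) + monicOP μ (n + 1)) := by
    rw [sub_add_cancel, orthonormalPoly, smul_eq_C_mul, mul_left_comm]
  rw [hsplit, map_smul, inner_smul_right, map_add, inner_add_right, horth, add_zero,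
    inner_orthonormalPoly_of_degree_le hμ hinf (degree_X_mul_monicOP_sub_le μ n),
    mul_div_cancel₀ _ hκ]

theorem valueAtInfinity_eq_coeff (μ : Measure ℂ) (n : ℕ) :
    (valueAtInfinity fun z : ℂ =>
        z ^ 2 * (monicOP μ n).eval z / (monicOP μ (n + 1)).eval z - z) =
      (X * monicOP μ n - monicOP μ (n + 1)).coeff n := by
  obtain ⟨hmonic, hdeg⟩ := monicOP_monic_natDegree μ (n + 1)
  have hle : (X * (X * monicOP μ n - monicOP μ (n + 1))).degree ≤ (monicOP μ (n + 1)).degree := by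
    rw [degree_mul, degree_X, degree_monicOP, add_comm]
    push_cast
    gcongr
    exact degree_X_mul_monicOP_sub_le μ n
  have hlim := tendsto_eval_div_eval_cobounded hmonic.ne_zero hle
  rw [hdeg, hmonic.leadingCoeff, div_one, coeff_X_mul] at hlim
  have hroot : ∀ᶠ z in Bornology.cobounded ℂ, (monicOP μ (n + 1)).eval z ≠ 0 :=
    Bornology.le_cofinite ℂ (eventually_cofinite_not_isRoot hmonic.ne_zero)
  refine tendsto_nhds_unique (tendsto_valueAtInfinity μ n) (hlim.congr' ?_)
  filter_upwards [hroot] with z hz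
  rw [eval_mul, eval_X, eval_sub, eval_mul, eval_X]
  field_simp

theorem isHyponormalHessenberg_toL2 (hμ : HasFiniteMoments μ) (hinf : μ.support.Infinite) :
    IsHyponormalHessenberg ℂ (fun n => toL2 hμ (orthonormalPoly μ n))
      (fun n => toL2 hμ (X * orthonormalPoly μ n)) fun n => conjMulL2 hμ (orthonormalPoly μ n) where
  orthonormal := orthonormal_toL2_orthonormalPoly hμ hinf
  mem_span _ := toL2_mem_span_orthonormalPoly hμ
    ((degree_X_mul_orthonormalPoly_le μ _).trans_lt (WithBot.coe_lt_coe.2 (Nat.lt_succ_self _)))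
  inner_adjoint _ _ := inner_conjMulL2 hμ _ _
  norm_adjoint_le _ := (norm_conjMulL2 hμ _).le

theorem tendsto_toL2_X_sub_C_mul_orthonormalPoly (hμ : HasFiniteMoments μ)
    (hinf : μ.support.Infinite)
    (hkappa : Tendsto (fun n => kappa μ n / kappa μ (n + 1)) atTop (𝓝 0)) {x : ℂ}
    (hx : Tendsto (fun n => (X * monicOP μ n - monicOP μ (n + 1)).coeff n) atTop (𝓝 x)) :
    Tendsto (fun n => toL2 hμ ((X - C x) * orthonormalPoly μ n)) atTop (𝓝 0) := by
  have h := (isHyponormalHessenberg_toL2 hμ hinf).tendsto_sub_smul (x := x)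
    (by simpa only [inner_orthonormalPoly_succ_X_mul hμ hinf, Complex.ofReal_zero] using
      hkappa.ofReal)
    (by simpa only [inner_orthonormalPoly_X_mul hμ hinf] using hx)
  simpa only [sub_mul, ← smul_eq_C_mul, map_sub, map_smul] using h

end OrthogonalPolynomials

end OrthoPoly

end

theorem theorem4p2_general {μ : Measure ℂ} (hμ : OrthoPoly.HasFiniteMoments μ)
    (hinf : μ.support.Infinite)
    (hkappa : Tendsto (fun n : ℕ => OrthoPoly.kappa μ n / OrthoPoly.kappa μ (n + 1)) atTop (𝓝 0))
    {x : ℂ}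
    (hx : Tendsto
      (fun n : ℕ => OrthoPoly.valueAtInfinity fun z : ℂ =>
        z ^ 2 * (OrthoPoly.monicOP μ n).eval z / (OrthoPoly.monicOP μ (n + 1)).eval z - z)
      atTop (𝓝 x))
    {E : Type*} [NormedAddCommGroup E] [NormedSpace ℝ E] [CompleteSpace E] {f : ℂ → E}
    (hf : AEStronglyMeasurable f μ) (hbdd : ∃ B, ∀ᵐ z ∂μ, ‖f z‖ ≤ B) (hcont : ContinuousAt f x) :
    Tendsto (fun n : ℕ => ∫ z, ‖(OrthoPoly.orthonormalPoly μ n).eval z‖ ^ 2 • f z ∂μ)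
      atTop (𝓝 (f x)) := by
  have hsq : ∀ (n : ℕ) (z : ℂ), dist z x ^ 2 * ‖(OrthoPoly.orthonormalPoly μ n).eval z‖ ^ 2 =
      ‖((X - C x) * OrthoPoly.orthonormalPoly μ n).eval z‖ ^ 2 := fun n z => by
    rw [eval_mul, norm_mul, mul_pow, eval_sub, eval_X, eval_C, dist_eq_norm]
  simp only [OrthoPoly.valueAtInfinity_eq_coeff] at hx
  refine OrthoPoly.tendsto_integral_smul_of_tendsto_integral_sq_dist (fun n z => by positivity)
    (fun n => (hμ.memLp_eval _).norm.integrable_sq) (fun n => ?_) (fun n => ?_) ?_ hf hbdd hcont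
  · rw [← OrthoPoly.norm_toL2_sq hμ,
      (OrthoPoly.orthonormal_toL2_orthonormalPoly hμ hinf).1, one_pow]
  · simp only [hsq]
    exact (hμ.memLp_eval _).norm.integrable_sq
  · simp only [hsq, ← OrthoPoly.norm_toL2_sq hμ]
    simpa using
      (OrthoPoly.tendsto_toL2_X_sub_C_mul_orthonormalPoly hμ hinf hkappa hx).norm.pow 2

theorem theorem4p2 (μ : Measure ℂ) [IsFiniteMeasure μ]
    (hcompact : IsCompact μ.support) (hinf : μ.support.Infinite)
    (hkappa : Tendsto (fun n : ℕ => OrthoPoly.kappa μ n / OrthoPoly.kappa μ (n + 1)) atTop (𝓝 0))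
    (x : ℂ)
    (hx : Tendsto
      (fun n : ℕ => OrthoPoly.valueAtInfinity fun z : ℂ =>
        z ^ 2 * (OrthoPoly.monicOP μ n).eval z / (OrthoPoly.monicOP μ (n + 1)).eval z - z)
      atTop (𝓝 x)) (j : ℕ) :
    Tendsto
      (fun n : ℕ => ∫ z, z ^ j * ((‖(OrthoPoly.orthonormalPoly μ n).eval z‖ ^ 2 : ℝ) : ℂ) ∂μ)
      atTop (𝓝 (x ^ j)) := by
  simpa [mul_comm] using theorem4p2_general
    (OrthoPoly.hasFiniteMoments_of_isCompact_support hcompact) hinf hkappa hx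
    (continuous_pow j).aestronglyMeasurable
    (OrthoPoly.ae_norm_pow_le_of_isCompact_support hcompact j) (continuous_pow j).continuousAt
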